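/- Let $G$ be a simple graph on the vertex set $[0,n]$, with every edge $(j,i)$ directed from the smaller vertex $j$ to the larger vertex $i$; let $G\backslash 0$ be $G$ with the vertex $0$ deleted, and let $F\subseteq E(G\backslash 0)$. Put $f_{i,j}=\#\{(j,k)\in F: k\le i\}$ and $b_i=\mathrm{indeg}_G(i)-\mathrm{outdeg}_F(i)$ for $i\in[n]$, and let $G[0,i]$ be the restriction of $G$ to the vertices $0,\dots,i$. Let $\mathrm{Sol}_G(F)$ be the set of integer arrays $(a_{i,j})_{1\le j\le i\le n}$ such that $a_{n,j}\ge 0$ for all $j\in[n]$; for $1\le j<i\le n$, $a_{i,j}+f_{i,j}\le a_{i-1,j}+f_{i-1,j}$ if $(j,i)\in E(G)$, with equality if $(j,i)\notin E(G)$; and $a_{i,i}=\#E(G[0,i])-\sum_{k<i}(a_{i,k}+f_{i,k})$ for $i\in[n]$. Let $\mathrm{LD}(G,F)$ be the multiset of the sequences $(a_{n,1},\dots,a_{n,n})$ for the arrays in $\mathrm{Sol}_G(F)$ (the left-degree sequences of $G$ belonging to $F$), and let $$L_{G,F}(t)=\sum_{\alpha\in \mathrm{LD}(G,F)}(-1)^{\#E(G)-\sum_i\alpha_i}\,t^\alpha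 .$$ Consider the graph on $[n]\cup\{t\}$ whose edges are those of $G\backslash 0$ together with $(j,t)$ for $j\in[n]$. A flow is an assignment $f$ of nonnegative real numbers to its edges such that outflow minus inflow is $b_i$ at each $i\in[n]$ and $-\#E(G\backslash F)$ at $t$, where $G\backslash F$ is $G$ with the edges in $F$ deleted. If there is a flow, put $z_I^F=\min_f\sum_{i\in I}f(i,t)$ for $I\subseteq[n]$, the minimum being over all flows $f$, and $$P_n^z\{z_I^F\}=\Big\{x\in\mathbb R^n:\ \sum_{i\in I}x_i\ge z_I^F\ \text{ for } I\ne[n],\quad \sum_{i=1}^n x_i=z_{[n]}^F\Big\}.$$ Then the following hold. 1. $\mathrm{Newton}(L_{G,F})=\mathrm{Conv}(\mathrm{LD}(G,F))$, and $L_{G,F}$ has polytopal support: every integer point of $\mathrm{Newton}(L_{G,F})$ is the exponent of a monomial of $L_{G,F}$ with nonzero coefficient. 2. If there is no flow, then $\mathrm{LD}(G,F)$ is empty. If there is a flow, then all the minima $z_I^F$ are attained; $z_\emptyset^F=0$ and $z^F_{I\cup J}+z^F_{I\cap J}\ge z^F_I+z^F_J$ for all $I,J\subseteq[n]$; $\mathrm{Newton}(L_{G,F})$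 is the generalized permutahedron $P_n^z\{z_I^F\}$; and every integer point of $P_n^z\{z_I^F\}$ is in $\mathrm{LD}(G,F)$. 3. Suppose that $b_i\ge 0$ for all $i\in[n]$ (for example, $F=\emptyset$, where $b_i=\mathrm{indeg}_G(i)$). Then there is a flow. Let $\Delta_I=\mathrm{Conv}\{e_i:i\in I\}$ for nonempty $I\subseteq[n]$ and $\Delta_\emptyset=\{0\}$. Let $\mathcal L$ be the lattice of all $J\subseteq[n]$ such that no edge of $G$ goes from a vertex in $J$ to a vertex outside $J$. For $J\subseteq[n]$ put $y_J^F=b_k$ if $J$ is a join-irreducible element of $\mathcal L$, $J'$ is the element of $\mathcal L$ that it covers, and $J\setminus J'=\{k\}$; put $y_J^F=0$ if $J$ is not a join-irreducible element of $\mathcal L$. Let $\delta(i)$ be the set of vertices that can be reached from $i$ by an increasing path in $G$, including $i$ itself. Then, with Minkowski sums, $$\sum_{J\subseteq[n]}y_J^F\,\Delta_J=P_n^z\{z_I^F\}\qquad\text{and}\qquad \mathrm{Newton}(L_{G,F})=\sum_{i=1}^n b_i\,\Delta_{\delta(i)} .$$ -/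

import Mathlib

namespace LeftDegree

open Finset
open scoped Pointwise

noncomputable section

/-! A simple graph on the vertex set `[0,n]` is a `SimpleGraph (Fin (n + 1))`; its edges are directed
from the smaller to the larger vertex. The vertices `1, …, n` are indexed by `Fin n`: the index
`i : Fin n` stands for the vertex `i.succ`. -/

open Classical in
/-- The directed edges of `G`. -/
def arcs {n : ℕ} (G : SimpleGraph (Fin (n + 1))) : Finset (Fin (n + 1) × Fin (n + 1)) :=
  univ.filter fun e => e.1 < e.2 ∧ G.Adj e.1 e.2

open Classical in
/-- The directed edges of `G \ 0`, that is `G` with the vertex `0` deleted. -/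
def arcsWithoutZero {n : ℕ} (G : SimpleGraph (Fin (n + 1))) : Finset (Fin n × Fin n) :=
  univ.filter fun e => e.1 < e.2 ∧ G.Adj e.1.succ e.2.succ

/-- The indegree in `G` of a vertex in `[n]`. -/
def indeg {n : ℕ} (G : SimpleGraph (Fin (n + 1))) (i : Fin n) : ℕ :=
  #((arcs G).filter fun e => e.2 = i.succ)

/-- The outdegree of a vertex in a set `F` of edges of `G \ 0`. -/
def outdeg {n : ℕ} (F : Finset (Fin n × Fin n)) (i : Fin n) : ℕ :=
  #(F.filter fun e => e.1 = i)

/-- The number of edges of `G[0,i]`, the restriction of `G` to the vertices `0, …, i`. -/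
def numArcsUpTo {n : ℕ} (G : SimpleGraph (Fin (n + 1))) (i : Fin n) : ℕ :=
  #((arcs G).filter fun e => e.2 ≤ i.succ)

/-- The number `f_{i,j}` of edges `(j,k)` in `F` with `k ≤ i`. -/
def shift {n : ℕ} (F : Finset (Fin n × Fin n)) (i j : Fin n) : ℕ :=
  #(F.filter fun e => e.1 = j ∧ e.2 ≤ i)

/-! ### Triangular constraint arrays and left-degree sequences -/

/-- `Sol_G(F)`: the integer solutions `(a_{i,j})`, `1 ≤ j ≤ i ≤ n`, of the constraint array `Tri_G(F)`,
which arises from `Tri_G(∅)` by replacing each `a_{i,j}` by `a_{i,j} + f_{i,j}` and each leftmost `0`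
by `f_{n,j}`. Arrays are extended by zero to the positions `j > i` (`zero_ext`). The case `i = 1` of
`diag` is the constraint `a_{1,1} = #E(G[0,1])`. -/
structure IsSol {n : ℕ} (G : SimpleGraph (Fin (n + 1))) (F : Finset (Fin n × Fin n))
    (a : Fin n → Fin n → ℤ) : Prop where
  zero_ext : ∀ i j, i < j → a i j = 0
  left : ∀ l j : Fin n, (l : ℕ) + 1 = n → (shift F l j : ℤ) ≤ a l j + shift F l j
  step_le : ∀ i' i j : Fin n, (i' : ℕ) + 1 = i → j ≤ i' → (j, i) ∈ arcsWithoutZero G →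
    a i j + shift F i j ≤ a i' j + shift F i' j
  step_eq : ∀ i' i j : Fin n, (i' : ℕ) + 1 = i → j ≤ i' → (j, i) ∉ arcsWithoutZero G →
    a i j + shift F i j = a i' j + shift F i' j
  diag : ∀ i : Fin n,
    a i i + shift F i i = numArcsUpTo G i - ∑ k ∈ univ.filter (· < i), (a i k + shift F i k)

theorem IsSol.antitone {n : ℕ} {G : SimpleGraph (Fin (n + 1))} {F : Finset (Fin n × Fin n)}
    {a : Fin n → Fin n → ℤ} (h : IsSol G F a) (j : Fin n) (d : ℕ) :
    ∀ i m : Fin n, (i : ℕ) + d = m → j ≤ i → a m j + shift F m j ≤ a i j + shift F i j := by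
  induction d with
  | zero =>
    intro i m hd _
    have : i = m := Fin.ext (by simpa using hd)
    rw [this]
  | succ d ih =>
    intro i m hd hj
    have hlt : (i : ℕ) + d < n := by have := m.2; omega
    have hj' : j ≤ (⟨i + d, hlt⟩ : Fin n) := by
      rw [Fin.le_def] at hj ⊢; simp only; omega
    have h1 := ih i ⟨i + d, hlt⟩ rfl hj
    have h2 : a m j + shift F m j ≤ a ⟨i + d, hlt⟩ j + shift F ⟨i + d, hlt⟩ j := by
      by_cases hm : (j, m) ∈ arcsWithoutZero G
      · exact h.step_le ⟨i + d, hlt⟩ m j (by simp only; omega) hj' hm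
      · exact (h.step_eq ⟨i + d, hlt⟩ m j (by simp only; omega) hj' hm).le
    exact h2.trans h1

theorem IsSol.nonneg {n : ℕ} {G : SimpleGraph (Fin (n + 1))} {F : Finset (Fin n × Fin n)}
    {a : Fin n → Fin n → ℤ} (h : IsSol G F a) (i j : Fin n) (hj : j ≤ i) : 0 ≤ a i j := by
  have hn : n - 1 < n := by have := i.2; omega
  have h1 := h.antitone j (n - 1 - i) i ⟨n - 1, hn⟩ (by have := i.2; simp only; omega) hj
  have h2 := h.left ⟨n - 1, hn⟩ j (by simp only; omega)
  have h3 : shift F i j ≤ shift F ⟨n - 1, hn⟩ j := by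
    refine card_le_card fun e he => ?_
    simp only [mem_filter] at he ⊢
    refine ⟨he.1, he.2.1, ?_⟩
    rw [Fin.le_def]; simp only
    have := e.2.2; omega
  omega

theorem IsSol.le {n : ℕ} {G : SimpleGraph (Fin (n + 1))} {F : Finset (Fin n × Fin n)}
    {a : Fin n → Fin n → ℤ} (h : IsSol G F a) (i j : Fin n) : a i j ≤ #(arcs G) := by
  rcases lt_or_ge i j with hij | hij
  · rw [h.zero_ext i j hij]; positivity
  · have h1 := h.antitone j (i - j) j i (by rw [Fin.le_def] at hij; omega) le_rfl
    have h2 := h.diag j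
    have h3 : (0 : ℤ) ≤ ∑ k ∈ univ.filter (· < j), (a j k + shift F j k) := by
      refine sum_nonneg fun k hk => ?_
      have := h.nonneg j k (mem_filter.1 hk).2.le
      positivity
    have h4 : numArcsUpTo G j ≤ #(arcs G) := card_le_card (filter_subset _ _)
    omega

theorem finite_isSol {n : ℕ} (G : SimpleGraph (Fin (n + 1))) (F : Finset (Fin n × Fin n)) :
    {a | IsSol G F a}.Finite := by
  refine (Set.finite_Icc (fun _ _ => 0 : Fin n → Fin n → ℤ) (fun _ _ => (#(arcs G) : ℤ))).subset ?_
  intro a (ha : IsSol G F a)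
  refine ⟨fun i j => ?_, fun i j => ha.le i j⟩
  rcases lt_or_ge i j with hij | hij
  · exact (ha.zero_ext i j hij).ge
  · exact ha.nonneg i j hij

/-- The finite set `Sol_G(F)`. -/
def sol {n : ℕ} (G : SimpleGraph (Fin (n + 1))) (F : Finset (Fin n × Fin n)) :
    Finset (Fin n → Fin n → ℤ) :=
  (finite_isSol G F).toFinset

/-- The first column `(a_{n,1}, …, a_{n,n})` of a triangular array. -/
def firstColumn {n : ℕ} (a : Fin n → Fin n → ℤ) : Fin n → ℤ :=
  fun j => a ⟨n - 1, Nat.sub_one_lt_of_lt j.2⟩ j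

/-- The multiset `LD(G,F)` of left-degree sequences: the first columns of the arrays in `Sol_G(F)`. -/
def LD {n : ℕ} (G : SimpleGraph (Fin (n + 1))) (F : Finset (Fin n × Fin n)) :
    Multiset (Fin n → ℤ) :=
  (sol G F).val.map firstColumn

/-- `codim(α) = #E(G) - (α_1 + ⋯ + α_n)`. -/
def codim {n : ℕ} (G : SimpleGraph (Fin (n + 1))) (α : Fin n → ℤ) : ℤ :=
  #(arcs G) - ∑ i, α i

/-- The polynomial `L_{G,F}(t)`, the sum of `(-1)^{codim(α)} t^α` over the multiset `LD(G,F)`. The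
entries of each `α` in `LD(G,F)` are nonnegative, so `Int.toNat` only changes their type. -/
def leftDegreePoly {n : ℕ} (G : SimpleGraph (Fin (n + 1))) (F : Finset (Fin n × Fin n)) :
    MvPolynomial (Fin n) ℤ :=
  ((LD G F).map fun α => MvPolynomial.monomial (Finsupp.equivFunOnFinite.symm fun i => (α i).toNat)
    ((codim G α).negOnePow : ℤ)).sum

/-- The point of `ℝ^n` given by an integer vector. -/
def toReal {n : ℕ} (α : Fin n → ℤ) : Fin n → ℝ := fun i => (α i : ℝ)

/-- The Newton polytope of a polynomial. -/
def newton {n : ℕ} (p : MvPolynomial (Fin n) ℤ) : Set (Fin n → ℝ) :=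
  convexHull ℝ ((fun (m : Fin n →₀ ℕ) (i : Fin n) => (m i : ℝ)) '' (p.support : Set (Fin n →₀ ℕ)))

/-- Each integer point of the Newton polytope of `p` is the exponent of a monomial of `p`. -/
def HasPolytopalSupport {n : ℕ} (p : MvPolynomial (Fin n) ℤ) : Prop :=
  ∀ α : Fin n → ℤ, toReal α ∈ newton p →
    ∃ m : Fin n →₀ ℕ, p.coeff m ≠ 0 ∧ ∀ i, (m i : ℤ) = α i

/-! ### Flows -/

/-- `f` is a flow with netflow vector `a` on the directed graph with edge set `E`; it is extended by
zero to the pairs that are not edges. -/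
structure IsFlow {V : Type*} [DecidableEq V] (E : Finset (V × V)) (a : V → ℝ) (f : V × V → ℝ) :
    Prop where
  nonneg : ∀ e ∈ E, 0 ≤ f e
  zero_ext : ∀ e, e ∉ E → f e = 0
  conservation : ∀ v, ∑ e ∈ E.filter (fun e => e.1 = v), f e - ∑ e ∈ E.filter (fun e => e.2 = v), f e
    = a v

/-- The edges of the graph on `[n] ∪ {t}` (where `t` is `none`) that consists of `G \ 0` and the edges
`(j,t)` for all `j` in `[n]`. -/
def extendedArcs {n : ℕ} (G : SimpleGraph (Fin (n + 1))) :
    Finset (Option (Fin n) × Option (Fin n)) :=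
  (arcsWithoutZero G).image (fun e => (some e.1, some e.2)) ∪ univ.image (fun j => (some j, none))

/-- The number `indeg_G(i) - outdeg_F(i)`. -/
def degDiff {n : ℕ} (G : SimpleGraph (Fin (n + 1))) (F : Finset (Fin n × Fin n)) (i : Fin n) : ℝ :=
  (indeg G i : ℝ) - outdeg F i

/-- The netflow vector `b_G^F`; its entry at `t` is `-#E(G \ F)`. -/
def netflow {n : ℕ} (G : SimpleGraph (Fin (n + 1))) (F : Finset (Fin n × Fin n)) :
    Option (Fin n) → ℝ
  | some i => degDiff G F i
  | none => -(#(arcs G \ F.image fun e => (e.1.succ, e.2.succ)) : ℝ)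

/-- The polytope of flows with netflow vector `b_G^F`. -/
def flows {n : ℕ} (G : SimpleGraph (Fin (n + 1))) (F : Finset (Fin n × Fin n)) :
    Set (Option (Fin n) × Option (Fin n) → ℝ) :=
  {f | IsFlow (extendedArcs G) (netflow G F) f}

/-- The values of `∑_{i ∈ I} f(i,t)` for the flows `f`. -/
def sinkValues {n : ℕ} (G : SimpleGraph (Fin (n + 1))) (F : Finset (Fin n × Fin n))
    (I : Finset (Fin n)) : Set ℝ :=
  (fun f => ∑ i ∈ I, f (some i, none)) '' flows G F

/-- The parameter `z_I^F`. -/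
def zParam {n : ℕ} (G : SimpleGraph (Fin (n + 1))) (F : Finset (Fin n × Fin n))
    (I : Finset (Fin n)) : ℝ :=
  sInf (sinkValues G F I)

/-! ### Generalized permutahedra -/

/-- The conditions on the parameters of a generalized permutahedron. -/
def IsGenPermParam {n : ℕ} (z : Finset (Fin n) → ℝ) : Prop :=
  z ∅ = 0 ∧ ∀ I J, z I + z J ≤ z (I ∪ J) + z (I ∩ J)

/-- The generalized permutahedron `P_n^z({z_I})`. -/
def genPermZ {n : ℕ} (z : Finset (Fin n) → ℝ) : Set (Fin n → ℝ) :=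
  {t | (∀ I, I ≠ univ → z I ≤ ∑ i ∈ I, t i) ∧ ∑ i, t i = z univ}

/-- The face `Δ_I` of the standard simplex, with `Δ_∅ = {0}`. -/
def simplexFace {n : ℕ} (I : Finset (Fin n)) : Set (Fin n → ℝ) :=
  if I = ∅ then {0} else convexHull ℝ ((fun i => Pi.single i (1 : ℝ)) '' (I : Set (Fin n)))

/-- The Minkowski sum `P_n^y({y_I})`, for nonnegative `y_I`. -/
def genPermY {n : ℕ} (y : Finset (Fin n) → ℝ) : Set (Fin n → ℝ) :=
  ∑ I : Finset (Fin n), y I • simplexFace I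

/-- The number of edges from vertices in `J` to vertices not in `J`. -/
def outdegSet {n : ℕ} (G : SimpleGraph (Fin (n + 1))) (J : Finset (Fin n)) : ℕ :=
  #((arcsWithoutZero G).filter fun e => e.1 ∈ J ∧ e.2 ∉ J)

theorem outdegSet_eq_zero {n : ℕ} (G : SimpleGraph (Fin (n + 1))) (J : Finset (Fin n)) :
    outdegSet G J = 0 ↔ ∀ e ∈ arcsWithoutZero G, e.1 ∈ J → e.2 ∈ J := by
  simp [outdegSet, filter_eq_empty_iff]

/-- The lattice of all `J ⊆ [n]` with outdegree `0`, ordered by inclusion. -/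
def closedSets {n : ℕ} (G : SimpleGraph (Fin (n + 1))) : Sublattice (Finset (Fin n)) where
  carrier := {J | outdegSet G J = 0}
  supClosed' := by
    intro A hA B hB
    simp only [Set.mem_ofPred_eq, outdegSet_eq_zero, sup_eq_union, mem_union] at *
    exact fun e he h => h.imp (hA e he) (hB e he)
  infClosed' := by
    intro A hA B hB
    simp only [Set.mem_ofPred_eq, outdegSet_eq_zero, inf_eq_inter, mem_inter] at *
    exact fun e he h => ⟨hA e he h.1, hB e he h.2⟩

open Classical in
/-- The parameter `y_J^F`: it is `indeg_G(k) - outdeg_F(k)` if `J` is a join-irreducible element of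
the lattice, `J` covers `J'` and `J \ J' = {k}` (as `J` covers only one element, at most one summand is
nonzero), and `0` if `J` is not a join-irreducible element. -/
def yParam {n : ℕ} (G : SimpleGraph (Fin (n + 1))) (F : Finset (Fin n × Fin n))
    (J : Finset (Fin n)) : ℝ :=
  ∑ k, if ∃ A A' : closedSets G, (A : Finset (Fin n)) = J ∧ SupIrred A ∧ A' ⋖ A ∧
    (A : Finset (Fin n)) \ (A' : Finset (Fin n)) = {k} then degDiff G F k else 0

open Classical in
/-- `δ(i)`: the vertices that can be reached from `i` by an increasing path, including `i`. -/
def reachable {n : ℕ} (G : SimpleGraph (Fin (n + 1))) (i : Fin n) : Finset (Fin n) :=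
  univ.filter fun k => Relation.ReflTransGen (fun u v => (u, v) ∈ arcsWithoutZero G) i k

/-- The Minkowski sum of the simplices `(indeg_G(i) - outdeg_F(i)) Δ_{δ(i)}` over `i` in `[n]`. -/
def minkowskiSum {n : ℕ} (G : SimpleGraph (Fin (n + 1))) (F : Finset (Fin n × Fin n)) :
    Set (Fin n → ℝ) :=
  ∑ i : Fin n, degDiff G F i • simplexFace (reachable G i)

end

end LeftDegree

open LeftDegree

/-! Adding up the first `i` entries of row `i` of a triangular array telescopes: the drops
`a_{i-1,j} + f_{i-1,j} - (a_{i,j} + f_{i,j})` form an integral flow on `G \ 0` whose netflow at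
`j` is `b_j - α_j`, where `α` is the first column. By Gale's supply-demand theorem, `α` is
therefore a left-degree sequence if and only if it is an integer point of the polytope of all
`x ≥ 0` with `∑_J x ≥ ∑_J b` for each closed set `J` (one that no edge leaves), with equality for
`J = [n]`. The same theorem over `ℝ` identifies the points of this polytope with the sink values
of the flows.

Closed sets form a lattice, so `I ↦ max {∑_J b | J ⊆ I closed}` is supermodular, and its
generalized permutahedron is the polytope above. The greedy algorithm minimizes each linear
functional at an integer point: hence the polytope is the convex hull of the left-degree
sequences, and the minima `z_I` are attained. Terms of `L_{G,F}` with equal exponents have equal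
signs, so none cancel.

If `b ≥ 0`, Gale's theorem for the bipartite graph that joins `i` to the elements of `δ(i)` writes
each point of the polytope as a sum of points of the simplices `b_i Δ_{δ(i)}`. The
join-irreducible closed sets are the `δ(k)`, and `δ(k)` covers `δ(k) \ {k}`. -/

namespace LeftDegree

open Finset
open scoped Pointwise

/-! ### Flows and cuts in directed graphs -/

section Networks

variable {V R : Type*}

/-- No edge in `E` leaves the vertex set `J`. -/
def OutClosed (E : Finset (V × V)) (J : Finset V) : Prop :=
  ∀ e ∈ E, e.1 ∈ J → e.2 ∈ J

theorem outClosed_empty (E : Finset (V × V)) : OutClosed E ∅ :=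
  fun _ _ h => absurd h (notMem_empty _)

theorem outClosed_univ [Fintype V] (E : Finset (V × V)) : OutClosed E univ :=
  fun _ _ _ => mem_univ _

variable [DecidableEq V]

theorem OutClosed.union {E : Finset (V × V)} {J K : Finset V} (hJ : OutClosed E J)
    (hK : OutClosed E K) : OutClosed E (J ∪ K) := fun e he h =>
  mem_union.2 ((mem_union.1 h).imp (hJ e he) (hK e he))

theorem OutClosed.inter {E : Finset (V × V)} {J K : Finset V} (hJ : OutClosed E J)
    (hK : OutClosed E K) : OutClosed E (J ∩ K) := fun e he h =>
  mem_inter.2 ((mem_inter.1 h).imp (hJ e he) (hK e he))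

theorem OutClosed.insert {E : Finset (V × V)} {J : Finset V} (hJ : OutClosed E J) {u v : V}
    (huv : u ∈ J → v ∈ J) : OutClosed (insert (u, v) E) J :=
  forall_mem_insert _ _ _ |>.2 ⟨huv, hJ⟩

section AddCommGroup

variable [AddCommGroup R]

/-- Outflow minus inflow of `g` at the vertex `v` of the directed graph with edge set `E`. -/
def excess (E : Finset (V × V)) (g : V × V → R) (v : V) : R :=
  ∑ e ∈ E with e.1 = v, g e - ∑ e ∈ E with e.2 = v, g e

theorem sum_excess (E : Finset (V × V)) (g : V × V → R) (J : Finset V) :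
    ∑ v ∈ J, excess E g v = ∑ e ∈ E with e.1 ∈ J, g e - ∑ e ∈ E with e.2 ∈ J, g e := by
  simp only [excess, sum_sub_distrib, sum_filter]
  rw [sum_comm, sum_comm (s := J)]
  simp only [sum_ite_eq]

theorem excess_insert_update {E : Finset (V × V)} {u v : V} (huv : (u, v) ∉ E) (g : V × V → R)
    (s : R) : excess (insert (u, v) E) (Function.update g (u, v) s) =
      excess E g + Pi.single u s - Pi.single v s := by
  have sum_update : ∀ (P : V × V → Prop) [DecidablePred P],
      ∑ e ∈ insert (u, v) E with P e, Function.update g (u, v) s e =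
        (if P (u, v) then s else 0) + ∑ e ∈ E with P e, g e := fun P _ => by
    rw [sum_filter, sum_insert huv, Function.update_self, sum_filter]
    exact congrArg _ <| sum_congr rfl fun e he => by
      rw [Function.update_of_ne (ne_of_mem_of_not_mem he huv)]
  ext w
  simp only [excess, sum_update, Pi.add_apply, Pi.sub_apply, Pi.single_apply, eq_comm (a := w)]
  abel

variable [LinearOrder R] [IsOrderedAddMonoid R]

theorem sum_excess_nonpos {E : Finset (V × V)} {g : V × V → R} (hg : ∀ e ∈ E, 0 ≤ g e)
    {J : Finset V} (hJ : OutClosed E J) : ∑ v ∈ J, excess E g v ≤ 0 := by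
  rw [sum_excess, sub_nonpos]
  refine sum_le_sum_of_subset_of_nonneg (fun e he => ?_) fun e he _ => hg e (mem_filter.1 he).1
  obtain ⟨heE, heJ⟩ := mem_filter.1 he
  exact mem_filter.2 ⟨heE, hJ e heE heJ⟩

theorem exists_flow_on_edge [Finite V] {E : Finset (V × V)} {u v : V} {d : V → R}
    (hd : ∀ J, OutClosed (insert (u, v) E) J → ∑ i ∈ J, d i ≤ 0) :
    ∃ s : R, 0 ≤ s ∧ ∀ J, OutClosed E J →
      ∑ i ∈ J, (d - Pi.single u s + Pi.single v s : V → R) i ≤ 0 := by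
  classical
  cases nonempty_fintype V
  -- `s` must be at least the excess demand of each set that is out-closed once `(u, v)` is removed
  -- and does not contain `v`; the largest of these lower bounds works, by uncrossing.
  obtain ⟨J₀, hJ₀, hmax⟩ := exists_max_image {J : Finset V | OutClosed E J ∧ v ∉ J}
    (fun J => ∑ i ∈ J, d i) ⟨∅, by simp [outClosed_empty]⟩
  simp only [mem_filter, mem_univ, true_and] at hJ₀ hmax
  have max_nonneg : 0 ≤ ∑ i ∈ J₀, d i := by
    simpa using hmax ∅ ⟨outClosed_empty E, notMem_empty v⟩
  refine ⟨_, max_nonneg, fun J hJ => ?_⟩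
  have sum_eq : ∀ s : R, ∑ i ∈ J, (d - Pi.single u s + Pi.single v s : V → R) i =
      ∑ i ∈ J, d i - (if u ∈ J then s else 0) + if v ∈ J then s else 0 := fun s => by
    simp [sum_add_distrib, Pi.single_apply]
  rw [sum_eq]
  by_cases hv : v ∈ J
  · by_cases hu : u ∈ J
    · simpa [hu, hv] using hd J (hJ.insert fun _ => hv)
    · have h_union := hd (J ∪ J₀) ((hJ.union hJ₀.1).insert fun _ => mem_union_left _ hv)
      have h_inter := hd (J ∩ J₀) ((hJ.inter hJ₀.1).insert fun h => absurd (mem_inter.1 h).1 hu)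
      simpa [hu, hv, sum_union_inter] using add_nonpos h_union h_inter
  · by_cases hu : u ∈ J
    · simpa [hu, hv] using hmax J ⟨hJ, hv⟩
    · simpa [hu, hv] using hd J (hJ.insert fun h => absurd h hu)

theorem exists_nonneg_excess_eq [Fintype V] (E : Finset (V × V)) {d : V → R} (hd₀ : ∑ v, d v = 0)
    (hd : ∀ J, OutClosed E J → ∑ v ∈ J, d v ≤ 0) : ∃ g, 0 ≤ g ∧ excess E g = d := by
  induction E using Finset.induction_on generalizing d with
  | empty =>
    have d_nonpos : ∀ v ∈ univ, d v ≤ 0 := fun v _ => by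
      simpa using hd {v} fun e he => absurd he (notMem_empty e)
    have d_eq_zero := (sum_eq_zero_iff_of_nonpos d_nonpos).1 hd₀
    exact ⟨0, le_rfl, funext fun v => by simp [excess, d_eq_zero v (mem_univ v)]⟩
  | insert p E hp ih =>
    obtain ⟨u, v⟩ := p
    obtain ⟨s, hs, hres⟩ := exists_flow_on_edge hd
    obtain ⟨g, hg, hgd⟩ := ih (by simp [sum_add_distrib, hd₀]) hres
    refine ⟨Function.update g (u, v) s, le_update_iff.2 ⟨hs, fun e _ => hg e⟩, ?_⟩
    rw [excess_insert_update hp, hgd]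
    abel

end AddCommGroup

/-- The points `x ≥ 0` whose sum over each out-closed vertex set is at least the supply `b` of that
set, with equality for the set of all vertices. By Gale's theorem, these are the ways to distribute
the supply `b` over the vertices by moving it along the edges. -/
def cutPolytope [Fintype V] [AddCommMonoid R] [LE R] (E : Finset (V × V)) (b : V → R) :
    Set (V → R) :=
  {x | 0 ≤ x ∧ (∀ J, OutClosed E J → ∑ v ∈ J, b v ≤ ∑ v ∈ J, x v) ∧ ∑ v, x v = ∑ v, b v}

theorem mem_cutPolytope_iff_exists_excess_eq [Fintype V] [AddCommGroup R] [LinearOrder R]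
    [IsOrderedAddMonoid R] {E : Finset (V × V)} {b x : V → R} :
    x ∈ cutPolytope E b ↔ 0 ≤ x ∧ ∃ g, (∀ e ∈ E, 0 ≤ g e) ∧ excess E g = b - x := by
  refine and_congr_right fun _ => ⟨fun ⟨hle, heq⟩ => ?_, fun ⟨g, hg, hgb⟩ => ?_⟩
  · obtain ⟨g, hg, hgb⟩ := exists_nonneg_excess_eq E (d := b - x) (by simp [heq])
      fun J hJ => by simpa using hle J hJ
    exact ⟨g, fun e _ => hg e, hgb⟩
  · have sum_eq : ∀ J : Finset V, ∑ v ∈ J, excess E g v = ∑ v ∈ J, b v - ∑ v ∈ J, x v := by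
      simp [hgb]
    refine ⟨fun J hJ => sub_nonpos.1 (sum_eq J ▸ sum_excess_nonpos hg hJ), ?_⟩
    have total : ∑ v, excess E g v = 0 := by simp [sum_excess]
    exact (sub_eq_zero.1 (sum_eq univ ▸ total)).symm

end Networks

/-! ### Supermodular functions and generalized permutahedra -/

section Supermodular

variable {V R : Type*}

theorem mul_sum_le_sum_mul_of_superlevel [CommRing R] [LinearOrder R] [IsStrictOrderedRing R]
    {c δ : V → R} {s : Finset V} (hδ : ∀ t, 0 ≤ ∑ i ∈ s with t < c i, δ i) {γ : R}
    (hγ : ∀ i ∈ s, γ ≤ c i) : γ * ∑ i ∈ s, δ i ≤ ∑ i ∈ s, c i * δ i := by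
  induction s using Finset.strongInduction generalizing γ with
  | H s ih =>
    obtain rfl | hs := s.eq_empty_or_nonempty
    · simp
    obtain ⟨a, ha, hmin⟩ := s.exists_min_image c hs
    have sum_nonneg : 0 ≤ ∑ i ∈ s, δ i := by
      simpa [filter_true_of_mem fun i hi => (sub_one_lt _).trans_le (hmin i hi)] using hδ (c a - 1)
    have upper := ih {i ∈ s | c a < c i} (filter_ssubset.2 ⟨a, ha, lt_irrefl _⟩)
      (γ := c a) (fun t => by simpa only [filter_filter, max_lt_iff] using hδ (max (c a) t))
      fun i hi => (mem_filter.1 hi).2.le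
    have lower : ∑ i ∈ s with ¬ c a < c i, c i * δ i = c a * ∑ i ∈ s with ¬ c a < c i, δ i := by
      rw [mul_sum]
      refine sum_congr rfl fun i hi => ?_
      obtain ⟨his, hi⟩ := mem_filter.1 hi
      rw [le_antisymm (not_lt.1 hi) (hmin i his)]
    calc γ * ∑ i ∈ s, δ i ≤ c a * ∑ i ∈ s, δ i := by gcongr; exact hγ a ha
      _ ≤ ∑ i ∈ s, c i * δ i := by
        rw [← sum_filter_add_sum_filter_not s (c a < c ·),
          ← sum_filter_add_sum_filter_not s (c a < c ·) fun i => c i * δ i, lower, mul_add]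
        gcongr

variable [DecidableEq V]

/-- Supermodularity of a set function, the condition on the parameters of a generalized
permutahedron besides the normalization `w ∅ = 0`. -/
def IsSupermodular [Add R] [LE R] (w : Finset V → R) : Prop :=
  ∀ I J, w I + w J ≤ w (I ∪ J) + w (I ∩ J)

/- Greedy algorithm: the elements are added in order of decreasing `c`, and each one receives the
increment of `w`. -/
theorem IsSupermodular.exists_tight_on_superlevel [AddCommGroup R] [PartialOrder R]
    [IsOrderedAddMonoid R] {K : Type*} [LinearOrder K] {w : Finset V → R} (hw : IsSupermodular w)
    (hw₀ : w ∅ = 0) (c : V → K) (s : Finset V) :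
    ∃ y : V → R, (∀ I ⊆ s, w I ≤ ∑ i ∈ I, y i) ∧ ∑ i ∈ s, y i = w s ∧
      ∀ t, ∑ i ∈ s with t < c i, y i = w {i ∈ s | t < c i} := by
  induction s using Finset.induction_on_min_value c with
  | empty => exact ⟨0, by simp [hw₀], by simp [hw₀], by simp [hw₀]⟩
  | insert a s ha hmin ih =>
    obtain ⟨y, hy, hys, hyt⟩ := ih
    set y' := Function.update y a (w (insert a s) - w s) with hy'
    have sum_y' : ∀ I ⊆ s, ∑ i ∈ I, y' i = ∑ i ∈ I, y i := fun I hI =>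
      sum_congr rfl fun i hi => Function.update_of_ne (ne_of_mem_of_not_mem (hI hi) ha) _ _
    have sum_insert_y' : ∀ I ⊆ s, ∑ i ∈ insert a I, y' i = w (insert a s) - w s + ∑ i ∈ I, y i :=
      fun I hI => by rw [sum_insert fun h => ha (hI h), sum_y' I hI, hy', Function.update_self]
    have total : ∑ i ∈ insert a s, y' i = w (insert a s) := by
      rw [sum_insert_y' s Subset.rfl, hys, sub_add_cancel]
    refine ⟨y', fun I hI => ?_, total, fun t => ?_⟩
    · by_cases haI : a ∈ I
      · obtain ⟨J, hJs, rfl⟩ : ∃ J ⊆ s, insert a J = I :=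
          ⟨I.erase a, subset_insert_iff.1 hI, insert_erase haI⟩
        have supermodular := hw (insert a J) s
        rw [insert_union, union_eq_right.2 hJs, insert_inter_of_notMem ha,
          inter_eq_left.2 hJs] at supermodular
        rw [sum_insert_y' J hJs, sub_add_eq_add_sub, le_sub_iff_add_le]
        exact supermodular.trans (add_le_add_right (hy J hJs) _)
      · have hIs := (subset_insert_iff_of_notMem haI).1 hI
        exact (hy I hIs).trans_eq (sum_y' I hIs).symm
    · by_cases hta : t < c a
      · rw [filter_true_of_mem fun i hi => ?_, total]
        obtain rfl | hi := mem_insert.1 hi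
        · exact hta
        · exact hta.trans_le (hmin i hi)
      · rw [filter_insert, if_neg hta, sum_y' _ (filter_subset _ _), hyt]

end Supermodular

theorem subset_convexHull_of_forall_exists_le {ι : Type*} [Fintype ι] {T P : Set (ι → ℝ)}
    (hT : T.Finite) (h : ∀ c : ι → ℝ, ∃ t ∈ T, ∀ x ∈ P, c ⬝ᵥ t ≤ c ⬝ᵥ x) :
    P ⊆ convexHull ℝ T := by
  classical
  intro x hx
  by_contra hxT
  obtain ⟨f, u, hf, hfx⟩ := geometric_hahn_banach_closed_point (convex_convexHull ℝ T)
    (hT.isClosed_convexHull (𝕜 := ℝ)) hxT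
  have f_eq : ∀ y : ι → ℝ, (fun i => -f (Pi.single i 1)) ⬝ᵥ y = -f y := fun y => by
    conv_rhs => rw [← univ_sum_single y, map_sum, ← sum_neg_distrib]
    refine sum_congr rfl fun i _ => ?_
    have single_eq : Pi.single i (y i) = y i • Pi.single (M := fun _ => ℝ) i 1 := by
      rw [← Pi.single_smul, smul_eq_mul, mul_one]
    rw [single_eq, map_smul, smul_eq_mul, mul_comm, mul_neg]
  obtain ⟨t, ht, hle⟩ := h fun i => -f (Pi.single i 1)
  have f_le := hle x hx
  rw [f_eq, f_eq, neg_le_neg_iff] at f_le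
  exact (f_le.trans_lt (hf t (subset_convexHull ℝ T ht))).not_gt hfx

section GenPerm

variable {n : ℕ}

theorem sum_toReal (I : Finset (Fin n)) (α : Fin n → ℤ) :
    ∑ i ∈ I, toReal α i = (∑ i ∈ I, α i : ℤ) := by
  simp [toReal]

theorem mem_genPermZ {z : Finset (Fin n) → ℝ} {x : Fin n → ℝ} :
    x ∈ genPermZ z ↔ (∀ I, z I ≤ ∑ i ∈ I, x i) ∧ ∑ i, x i = z univ :=
  ⟨fun h => ⟨fun I => (eq_or_ne I univ).elim (fun hI => hI ▸ h.2.ge) (h.1 I), h.2⟩,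
    fun h => ⟨fun I _ => h.1 I, h.2⟩⟩

theorem convex_genPermZ (z : Finset (Fin n) → ℝ) : Convex ℝ (genPermZ z) := by
  have isLinearMap_sum : ∀ I : Finset (Fin n), IsLinearMap ℝ fun x : Fin n → ℝ => ∑ i ∈ I, x i :=
    fun I => ⟨by simp [sum_add_distrib], by simp [mul_sum]⟩
  have : genPermZ z = (⋂ I, {x | z I ≤ ∑ i ∈ I, x i}) ∩ {x | ∑ i, x i = z univ} := by
    ext x
    simp [mem_genPermZ]
  rw [this]
  exact (convex_iInter fun I => convex_halfSpace_ge (isLinearMap_sum I) _).inter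
    (convex_hyperplane (isLinearMap_sum univ) _)

theorem IsGenPermParam.isLeast_sum {z : Finset (Fin n) → ℝ} (hz : IsGenPermParam z)
    (I : Finset (Fin n)) : IsLeast ((fun x => ∑ i ∈ I, x i) '' genPermZ z) (z I) := by
  obtain ⟨x, hx, hx_univ, hx_superlevel⟩ :=
    IsSupermodular.exists_tight_on_superlevel hz.2 hz.1 (· ∈ I) univ
  refine ⟨⟨x, mem_genPermZ.2 ⟨fun J => hx J (subset_univ J), hx_univ⟩, ?_⟩, ?_⟩
  · simpa [lt_iff_le_not_ge] using hx_superlevel False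
  · rintro _ ⟨x, hx, rfl⟩
    exact (mem_genPermZ.1 hx).1 I

theorem finite_intPoints_genPermZ (z : Finset (Fin n) → ℝ) : (toReal ⁻¹' genPermZ z).Finite := by
  refine (Set.finite_Icc (fun i => ⌊z {i}⌋) fun i => ⌈z univ - z {i}ᶜ⌉).subset fun α hα => ?_
  obtain ⟨hle, heq⟩ := mem_genPermZ.1 hα
  refine ⟨fun i => ?_, fun i => ?_⟩
  · exact Int.cast_le.1 ((Int.floor_le _).trans (by simpa [toReal] using hle {i}))
  · have compl := sum_compl_add_sum {i} (toReal α)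
    rw [heq, sum_singleton] at compl
    exact Int.cast_le.1 (le_trans (by simp only [toReal] at *; linarith [hle {i}ᶜ]) (Int.le_ceil _))

theorem convexHull_intPoints_genPermZ {w : Finset (Fin n) → ℤ} (hw : IsSupermodular w)
    (hw₀ : w ∅ = 0) :
    convexHull ℝ (toReal '' (toReal ⁻¹' genPermZ fun I => (w I : ℝ))) =
      genPermZ fun I => (w I : ℝ) := by
  refine (convexHull_min (Set.image_preimage_subset _ _) (convex_genPermZ _)).antisymm <|
    subset_convexHull_of_forall_exists_le ((finite_intPoints_genPermZ _).image _) fun c => ?_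
  obtain ⟨y, hy, hy_univ, hy_superlevel⟩ := hw.exists_tight_on_superlevel hw₀ c univ
  have y_mem : toReal y ∈ genPermZ fun I => (w I : ℝ) :=
    mem_genPermZ.2 ⟨fun I => sum_toReal I y ▸ Int.cast_le.2 (hy I (subset_univ I)),
      by rw [sum_toReal, hy_univ]⟩
  refine ⟨_, ⟨y, y_mem, rfl⟩, fun x hx => ?_⟩
  obtain ⟨hx, hx_univ⟩ := mem_genPermZ.1 hx
  obtain ⟨γ, hγ⟩ := (Set.finite_range c).bddBelow
  have superlevel_nonneg : ∀ t, 0 ≤ ∑ i with t < c i, (x - toReal y) i := fun t => by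
    simpa [sum_toReal, hy_superlevel t] using hx {i | t < c i}
  have layer_cake := mul_sum_le_sum_mul_of_superlevel superlevel_nonneg fun i _ => hγ ⟨i, rfl⟩
  have total : ∑ i, (x - toReal y) i = 0 := by simp [hx_univ, y_mem.2]
  rw [total, mul_zero] at layer_cake
  simpa [dotProduct, mul_sub] using layer_cake

end GenPerm

/-! ### The supermodular function of a cut polytope -/

section CutBound

variable {V R : Type*}

theorem mem_cutPolytope_self [Fintype V] [AddCommMonoid R] [Preorder R] (E : Finset (V × V))
    {b : V → R} (hb : 0 ≤ b) : b ∈ cutPolytope E b :=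
  ⟨hb, fun _ _ => le_rfl, rfl⟩

variable [AddCommMonoid R] [LinearOrder R]

open Classical in
/-- The largest total supply of an out-closed set contained in `I`: a lower bound on the sum over
`I` of a point of `cutPolytope E b`. -/
noncomputable def cutBound (E : Finset (V × V)) (b : V → R) (I : Finset V) : R :=
  {J ∈ I.powerset | OutClosed E J}.sup'
    ⟨∅, mem_filter.2 ⟨empty_mem_powerset I, outClosed_empty E⟩⟩ fun J => ∑ v ∈ J, b v

theorem sum_le_cutBound {E : Finset (V × V)} (b : V → R) {I J : Finset V} (hJ : OutClosed E J)
    (hJI : J ⊆ I) : ∑ v ∈ J, b v ≤ cutBound E b I := by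
  classical exact le_sup' (fun J => ∑ v ∈ J, b v) (mem_filter.2 ⟨mem_powerset.2 hJI, hJ⟩)

theorem exists_cutBound_eq_sum (E : Finset (V × V)) (b : V → R) (I : Finset V) :
    ∃ J ⊆ I, OutClosed E J ∧ cutBound E b I = ∑ v ∈ J, b v := by
  classical
  obtain ⟨J, hJ, hsum⟩ := exists_mem_eq_sup' (s := {J ∈ I.powerset | OutClosed E J})
    ⟨∅, mem_filter.2 ⟨empty_mem_powerset I, outClosed_empty E⟩⟩ fun J => ∑ v ∈ J, b v
  exact ⟨J, mem_powerset.1 (mem_filter.1 hJ).1, (mem_filter.1 hJ).2, hsum⟩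

theorem cutBound_empty (E : Finset (V × V)) (b : V → R) : cutBound E b ∅ = 0 := by
  obtain ⟨J, hJ, -, hsum⟩ := exists_cutBound_eq_sum E b ∅
  rw [hsum, subset_empty.1 hJ, sum_empty]

theorem isSupermodular_cutBound [DecidableEq V] [IsOrderedAddMonoid R] (E : Finset (V × V))
    (b : V → R) : IsSupermodular (cutBound E b) := fun I J => by
  obtain ⟨A, hAI, hA, hsumA⟩ := exists_cutBound_eq_sum E b I
  obtain ⟨B, hBJ, hB, hsumB⟩ := exists_cutBound_eq_sum E b J
  rw [hsumA, hsumB, ← sum_union_inter]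
  exact add_le_add (sum_le_cutBound b (hA.union hB) (union_subset_union hAI hBJ))
    (sum_le_cutBound b (hA.inter hB) (inter_subset_inter hAI hBJ))

end CutBound

section CutPolytope

variable {n : ℕ} {E : Finset (Fin n × Fin n)}

theorem cutBound_toReal (b : Fin n → ℤ) (I : Finset (Fin n)) :
    cutBound E (toReal b) I = ((cutBound E b I : ℤ) : ℝ) := by
  obtain ⟨J, hJI, hJ, hsum⟩ := exists_cutBound_eq_sum E b I
  obtain ⟨K, hKI, hK, hsumR⟩ := exists_cutBound_eq_sum E (toReal b) I
  apply le_antisymm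
  · rw [hsumR, sum_toReal]
    exact Int.cast_le.2 (sum_le_cutBound b hK hKI)
  · rw [hsum, ← sum_toReal]
    exact sum_le_cutBound _ hJ hJI

theorem toReal_mem_cutPolytope {b α : Fin n → ℤ} :
    toReal α ∈ cutPolytope E (toReal b) ↔ α ∈ cutPolytope E b := by
  have toReal_nonneg : 0 ≤ toReal α ↔ 0 ≤ α := by simp [Pi.le_def, toReal]
  simp only [cutPolytope, Set.mem_ofPred_eq, sum_toReal, Int.cast_le, Int.cast_inj, toReal_nonneg]

theorem cutPolytope_eq_genPermZ {b : Fin n → ℝ} (h : (cutPolytope E b).Nonempty) :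
    cutPolytope E b = genPermZ (cutBound E b) := by
  have cutBound_le : ∀ x ∈ cutPolytope E b, ∀ I, cutBound E b I ≤ ∑ i ∈ I, x i := fun x hx I => by
    obtain ⟨J, hJI, hJ, hsum⟩ := exists_cutBound_eq_sum E b I
    rw [hsum]
    exact (hx.2.1 J hJ).trans (sum_le_sum_of_subset_of_nonneg hJI fun i _ _ => hx.1 i)
  have cutBound_univ : cutBound E b univ = ∑ i, b i := by
    obtain ⟨x, hx⟩ := h
    exact ((cutBound_le x hx univ).trans_eq hx.2.2).antisymm
      (sum_le_cutBound b (outClosed_univ E) Subset.rfl)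
  ext x
  rw [mem_genPermZ, cutBound_univ]
  refine ⟨fun hx => ⟨cutBound_le x hx, hx.2.2⟩,
    fun ⟨hle, heq⟩ => ⟨fun i => ?_, fun J hJ => ?_, heq⟩⟩
  · simpa using (sum_le_cutBound b (outClosed_empty E) (empty_subset {i})).trans (hle {i})
  · exact (sum_le_cutBound b hJ Subset.rfl).trans (hle J)

theorem convexHull_intPoints_cutPolytope (E : Finset (Fin n × Fin n)) (b : Fin n → ℤ) :
    convexHull ℝ (toReal '' cutPolytope E b) = cutPolytope E (toReal b) := by
  have intPoints : cutPolytope E b = toReal ⁻¹' cutPolytope E (toReal b) :=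
    Set.ext fun α => toReal_mem_cutPolytope.symm
  rw [intPoints]
  obtain h | h := (cutPolytope E (toReal b)).eq_empty_or_nonempty
  · simp [h]
  · rw [cutPolytope_eq_genPermZ h, funext (cutBound_toReal b)]
    exact convexHull_intPoints_genPermZ (isSupermodular_cutBound E b) (cutBound_empty E b)

end CutPolytope

/-! ### Left-degree sequences as integral flows -/

section EdgeCounts

variable {n : ℕ} {G : SimpleGraph (Fin (n + 1))}

theorem mem_arcs {e : Fin (n + 1) × Fin (n + 1)} : e ∈ arcs G ↔ e.1 < e.2 ∧ G.Adj e.1 e.2 := by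
  simp [arcs]

theorem mem_arcsWithoutZero {e : Fin n × Fin n} :
    e ∈ arcsWithoutZero G ↔ e.1 < e.2 ∧ G.Adj e.1.succ e.2.succ := by
  simp [arcsWithoutZero]

theorem fst_lt_snd {e : Fin n × Fin n} (he : e ∈ arcsWithoutZero G) : e.1 < e.2 :=
  (mem_arcsWithoutZero.1 he).1

variable (G) in
theorem card_filter_arcs (p : Fin (n + 1) → Prop) [DecidablePred p] :
    #{e ∈ arcs G | p e.2} = ∑ k with p k.succ, indeg G k := by
  simp only [indeg, card_filter]
  rw [sum_comm]
  refine sum_congr rfl fun e he => ?_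
  obtain ⟨k, hk⟩ := Fin.exists_succ_eq.2 (Fin.ne_zero_of_lt (mem_arcs.1 he).1)
  simp [← hk]

variable (G) in
theorem numArcsUpTo_eq_sum (i : Fin n) : numArcsUpTo G i = ∑ k ∈ Iic i, indeg G k := by
  simpa [numArcsUpTo, filter_ge_eq_Iic] using card_filter_arcs G (· ≤ i.succ)

theorem card_eq_sum_outdeg (F : Finset (Fin n × Fin n)) : #F = ∑ k, outdeg F k :=
  card_eq_sum_card_fiberwise fun _ _ => mem_univ _

variable {F : Finset (Fin n × Fin n)}

theorem card_arcs_sdiff_image (hF : F ⊆ arcsWithoutZero G) :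
    (#(arcs G \ F.image fun e => (e.1.succ, e.2.succ)) : ℝ) = ∑ i, degDiff G F i := by
  have image_subset : F.image (fun e => (e.1.succ, e.2.succ)) ⊆ arcs G := image_subset_iff.2
    fun e he => mem_arcs.2 ((mem_arcsWithoutZero.1 (hF he)).imp_left Fin.succ_lt_succ_iff.2)
  have card_image : #(F.image fun e => (e.1.succ, e.2.succ)) = #F :=
    card_image_of_injective F (Fin.succ_injective n |>.prodMap <| Fin.succ_injective n)
  have card_arcs : #(arcs G) = ∑ k, indeg G k := by simpa using card_filter_arcs G fun _ => True
  rw [cast_card_sdiff image_subset, card_image, card_arcs, card_eq_sum_outdeg F]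
  simp [degDiff]

variable (G F) in
/-- The vector `b` with entries `indeg_G(i) - outdeg_F(i)`, as an integer vector; `degDiff` is the
same vector in `ℝ^n`. -/
noncomputable def intDegDiff : Fin n → ℤ :=
  fun i => indeg G i - outdeg F i

variable (G F) in
theorem toReal_intDegDiff : toReal (intDegDiff G F) = degDiff G F := by
  ext i
  simp [toReal, intDegDiff, degDiff]

theorem shift_last {l : Fin n} (hl : (l : ℕ) + 1 = n) (j : Fin n) : shift F l j = outdeg F j :=
  congrArg card <| filter_congr fun e _ => and_iff_left <| Fin.le_def.2 (by omega)

end EdgeCounts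

theorem forall_sum_Iic_eq_iff {ι M : Type*} [PartialOrder ι] [LocallyFiniteOrderBot ι]
    [AddCancelCommMonoid M] {f g : ι → M} :
    (∀ i, ∑ k ∈ Iic i, f k = ∑ k ∈ Iic i, g k) ↔ f = g := by
  classical
  refine ⟨fun h => funext fun i => ?_, fun h _ => by rw [h]⟩
  induction i using (measure fun i : ι => #(Iic i)).wf.induction with
  | h i ih =>
    have eq_below : ∀ k ∈ Iio i, f k = g k := fun k hk =>
      ih k (card_lt_card (Iic_ssubset_Iic.2 (mem_Iio.1 hk)))
    have sum_Iic_eq := h i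
    rw [← Iio_insert, sum_insert notMem_Iio_self, sum_insert notMem_Iio_self,
      sum_congr rfl eq_below] at sum_Iic_eq
    exact add_right_cancel sum_Iic_eq

section Arrays

variable {n : ℕ} {G : SimpleGraph (Fin (n + 1))} {F : Finset (Fin n × Fin n)}

variable (G F) in
/-- The triangular array with first column `α` for which the value `a_{i,j} + f_{i,j}` drops by
`g (j, i)` from row `i - 1` to row `i` if `(j, i)` is an edge, and is unchanged otherwise. -/
noncomputable def flowArray (α : Fin n → ℤ) (g : Fin n × Fin n → ℤ) (i j : Fin n) : ℤ :=
  if j ≤ i then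
    α j + outdeg F j + ∑ e ∈ arcsWithoutZero G with e.1 = j ∧ i < e.2, g e - shift F i j
  else 0

theorem flowArray_add_shift (α : Fin n → ℤ) (g : Fin n × Fin n → ℤ) {i j : Fin n} (hj : j ≤ i) :
    flowArray G F α g i j + shift F i j =
      α j + outdeg F j + ∑ e ∈ arcsWithoutZero G with e.1 = j ∧ i < e.2, g e := by
  rw [flowArray, if_pos hj, sub_add_cancel]

theorem flowArray_last (α : Fin n → ℤ) (g : Fin n × Fin n → ℤ) {l : Fin n} (hl : (l : ℕ) + 1 = n)
    (j : Fin n) : flowArray G F α g l j = α j := by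
  have no_arc_above : {e ∈ arcsWithoutZero G | e.1 = j ∧ l < e.2} = ∅ :=
    filter_false_of_mem fun e _ h => by have := Fin.lt_def.1 h.2; omega
  rw [flowArray, if_pos (Fin.le_def.2 (by omega)), no_arc_above, shift_last hl]
  simp

theorem firstColumn_flowArray (α : Fin n → ℤ) (g : Fin n × Fin n → ℤ) :
    firstColumn (flowArray G F α g) = α :=
  funext fun j => flowArray_last α g (Nat.sub_add_cancel (Nat.one_le_of_lt j.2)) j

theorem flowArray_step (α : Fin n → ℤ) (g : Fin n × Fin n → ℤ) {i' i j : Fin n}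
    (hi : (i' : ℕ) + 1 = i) (hj : j ≤ i') :
    flowArray G F α g i' j + shift F i' j = flowArray G F α g i j + shift F i j +
      if (j, i) ∈ arcsWithoutZero G then g (j, i) else 0 := by
  rw [flowArray_add_shift α g hj, flowArray_add_shift α g (hj.trans (Fin.le_def.2 (by omega))),
    add_assoc _ (∑ e ∈ _ with _, g e), ← sum_ite_eq' (arcsWithoutZero G) (j, i) g, sum_filter,
    sum_filter, ← sum_add_distrib]
  refine congrArg _ <| sum_congr rfl fun ⟨u, v⟩ _ => ?_
  have lt_iff : i' < v ↔ i < v ∨ v = i := by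
    rw [Fin.lt_def, Fin.lt_def, Fin.ext_iff]
    omega
  obtain rfl | hv := eq_or_ne v i <;> simp_all

theorem sum_flowArray_row (α : Fin n → ℤ) (g : Fin n × Fin n → ℤ) (i : Fin n) :
    ∑ k ∈ Iic i, (flowArray G F α g i k + shift F i k) =
      ∑ k ∈ Iic i, (α k + outdeg F k + excess (arcsWithoutZero G) g k) := by
  rw [sum_congr rfl fun k hk => flowArray_add_shift α g (mem_Iic.1 hk), sum_add_distrib,
    sum_add_distrib (g := excess _ g), sum_excess]
  simp only [sum_filter (s := arcsWithoutZero G), mem_Iic]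
  rw [sum_comm, ← sum_sub_distrib]
  refine congrArg _ <| sum_congr rfl fun e he => ?_
  have fst_le : e.2 ≤ i → e.1 ≤ i := (fst_lt_snd he).le.trans
  by_cases h : e.2 ≤ i <;> simp [h, fst_le, not_le.1, not_lt.2]

theorem diag_flowArray_iff {α : Fin n → ℤ} {g : Fin n × Fin n → ℤ} :
    (∀ i, flowArray G F α g i i + shift F i i =
      numArcsUpTo G i - ∑ k with k < i, (flowArray G F α g i k + shift F i k)) ↔
      excess (arcsWithoutZero G) g = intDegDiff G F - α := by
  have row_iff : ∀ i, flowArray G F α g i i + shift F i i =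
      numArcsUpTo G i - ∑ k with k < i, (flowArray G F α g i k + shift F i k) ↔
      ∑ k ∈ Iic i, (α k + outdeg F k + excess (arcsWithoutZero G) g k) =
        ∑ k ∈ Iic i, (indeg G k : ℤ) := fun i => by
    rw [← sum_flowArray_row, ← Iio_insert, sum_insert notMem_Iio_self, filter_gt_eq_Iio,
      Iio_insert, eq_sub_iff_add_eq, numArcsUpTo_eq_sum, Nat.cast_sum]
  rw [forall_congr' row_iff, forall_sum_Iic_eq_iff, funext_iff, funext_iff]
  refine forall_congr' fun k => ?_
  rw [Pi.sub_apply, intDegDiff, sub_sub, add_comm (outdeg F k : ℤ), eq_sub_iff_add_eq']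

theorem exists_pred_of_lt {j i : Fin n} (h : j < i) : ∃ i' : Fin n, (i' : ℕ) + 1 = i ∧ j ≤ i' := by
  rw [Fin.lt_def] at h
  exact ⟨⟨i - 1, by omega⟩, by simp only; omega, Fin.le_def.2 (by simp only; omega)⟩

theorem isSol_flowArray_iff {α : Fin n → ℤ} {g : Fin n × Fin n → ℤ} :
    IsSol G F (flowArray G F α g) ↔ 0 ≤ α ∧ (∀ e ∈ arcsWithoutZero G, 0 ≤ g e) ∧
      excess (arcsWithoutZero G) g = intDegDiff G F - α := by
  constructor
  · intro h
    refine ⟨fun j => ?_, fun ⟨j, i⟩ he => ?_, diag_flowArray_iff.1 h.diag⟩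
    · have hl : n - 1 + 1 = n := Nat.sub_add_cancel (Nat.one_le_of_lt j.2)
      simpa [flowArray_last α g (l := ⟨n - 1, by omega⟩) hl] using h.left ⟨n - 1, by omega⟩ j hl
    · obtain ⟨i', hi, hj⟩ := exists_pred_of_lt (fst_lt_snd he)
      have step := h.step_le i' i j hi hj he
      rwa [flowArray_step α g hi hj, if_pos he, le_add_iff_nonneg_right] at step
  · rintro ⟨hα, hg, hexcess⟩
    refine ⟨fun i j hij => if_neg hij.not_ge, fun l j hl => ?_, fun i' i j hi hj he => ?_,
      fun i' i j hi hj he => ?_, diag_flowArray_iff.2 hexcess⟩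
    · rw [flowArray_last α g hl, le_add_iff_nonneg_left]
      exact hα j
    · rw [flowArray_step α g hi hj, if_pos he, le_add_iff_nonneg_right]
      exact hg _ he
    · rw [flowArray_step α g hi hj, if_neg he, add_zero]

theorem IsSol.exists_eq_flowArray {a : Fin n → Fin n → ℤ} (h : IsSol G F a) :
    ∃ g, a = flowArray G F (firstColumn a) g := by
  set g : Fin n × Fin n → ℤ := fun e =>
    let above : Fin n := ⟨e.2 - 1, by omega⟩
    a above e.1 + shift F above e.1 - (a e.2 e.1 + shift F e.2 e.1) with hg
  have step : ∀ {i' i j : Fin n}, (i' : ℕ) + 1 = i → j ≤ i' →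
      a i' j + shift F i' j = a i j + shift F i j +
        if (j, i) ∈ arcsWithoutZero G then g (j, i) else 0 := fun {i' i j} hi hj => by
    split_ifs with he
    · have above_eq : (⟨i - 1, by omega⟩ : Fin n) = i' := Fin.ext (by simp only; omega)
      simp only [hg, above_eq]
      ring
    · rw [h.step_eq i' i j hi hj he, add_zero]
  have eq_of_le : ∀ (d : ℕ) {i j : Fin n}, (i : ℕ) + d + 1 = n → j ≤ i →
      a i j = flowArray G F (firstColumn a) g i j := fun d => by
    induction d with
    | zero =>
      intro i j hi _
      rw [flowArray_last _ _ hi]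
      exact congrArg (a · j) (Fin.ext (by simp only; omega))
    | succ d ih =>
      intro i j hi hj
      have next_eq := ih (i := ⟨i + 1, by omega⟩) (j := j) (by simp only; omega)
        (Fin.le_def.2 (by simp only; omega))
      have := step (i := ⟨i + 1, by omega⟩) rfl hj
      have := flowArray_step (G := G) (F := F) (firstColumn a) g (i := ⟨i + 1, by omega⟩) rfl hj
      omega
  refine ⟨g, funext fun i => funext fun j => ?_⟩
  obtain hij | hji := lt_or_ge i j
  · rw [h.zero_ext i j hij, flowArray, if_neg hij.not_ge]
  · exact eq_of_le (n - 1 - i) (by omega) hji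

theorem mem_LD_iff {α : Fin n → ℤ} :
    α ∈ LD G F ↔ α ∈ cutPolytope (arcsWithoutZero G) (intDegDiff G F) := by
  have mem_LD : α ∈ LD G F ↔ ∃ a, IsSol G F a ∧ firstColumn a = α := by simp [LD, sol]
  rw [mem_LD, mem_cutPolytope_iff_exists_excess_eq]
  constructor
  · rintro ⟨a, ha, rfl⟩
    obtain ⟨g, hg⟩ := ha.exists_eq_flowArray
    rw [hg] at ha
    exact (isSol_flowArray_iff.1 ha).imp_right fun h => ⟨g, h⟩
  · rintro ⟨hα, g, hg⟩
    exact ⟨_, isSol_flowArray_iff.2 ⟨hα, hg⟩, firstColumn_flowArray α g⟩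

end Arrays

/-! ### Flows to the sink -/

section SinkFlows

variable {n : ℕ} {G : SimpleGraph (Fin (n + 1))} {F : Finset (Fin n × Fin n)}

theorem some_none_mem_extendedArcs (u : Fin n) : (some u, none) ∈ extendedArcs G := by
  simp [extendedArcs]

theorem some_some_mem_extendedArcs {u v : Fin n} :
    (some u, some v) ∈ extendedArcs G ↔ (u, v) ∈ arcsWithoutZero G := by
  simp [extendedArcs]

theorem sum_filter_extendedArcs (f : Option (Fin n) × Option (Fin n) → ℝ)
    (P : Option (Fin n) × Option (Fin n) → Prop) [DecidablePred P] :
    ∑ e ∈ extendedArcs G with P e, f e =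
      ∑ e ∈ arcsWithoutZero G with P (some e.1, some e.2), f (some e.1, some e.2) +
        ∑ j, if P (some j, none) then f (some j, none) else 0 := by
  have disjoint_images : Disjoint ((arcsWithoutZero G).image fun e => (some e.1, some e.2))
      (univ.image fun j => (some j, none)) := by
    simp +contextual [disjoint_left, eq_comm]
  rw [sum_filter, extendedArcs, sum_union disjoint_images, sum_image, sum_image, sum_filter]
  · exact fun i _ j _ h => Option.some_injective _ (Prod.ext_iff.1 h).1
  · exact (Option.some_injective _ |>.prodMap <| Option.some_injective _).injOn

theorem excess_extendedArcs_some (f : Option (Fin n) × Option (Fin n) → ℝ) (v : Fin n) :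
    excess (extendedArcs G) f (some v) =
      excess (arcsWithoutZero G) (fun e => f (some e.1, some e.2)) v + f (some v, none) := by
  simp [excess, sum_filter_extendedArcs, add_sub_right_comm]

theorem excess_extendedArcs_none (f : Option (Fin n) × Option (Fin n) → ℝ) :
    excess (extendedArcs G) f none = -∑ i, f (some i, none) := by
  simp [excess, sum_filter_extendedArcs]

variable (G) in
/-- The function on pairs of vertices of the graph with sink `none` that is `g` on the edges of
`G \ 0`, `x` on the edges to the sink, and zero on the other pairs. -/
noncomputable def sinkFlow (g : Fin n × Fin n → ℝ) (x : Fin n → ℝ) :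
    Option (Fin n) × Option (Fin n) → ℝ
  | (some u, some v) => if (u, v) ∈ arcsWithoutZero G then g (u, v) else 0
  | (some u, none) => x u
  | (none, _) => 0

theorem excess_sinkFlow_some (g : Fin n × Fin n → ℝ) (x : Fin n → ℝ) (v : Fin n) :
    excess (extendedArcs G) (sinkFlow G g x) (some v) = excess (arcsWithoutZero G) g v + x v := by
  have inner_eq : ∀ e ∈ arcsWithoutZero G, sinkFlow G g x (some e.1, some e.2) = g e :=
    fun e he => if_pos he
  rw [excess_extendedArcs_some, excess, excess,
    sum_congr rfl fun e he => inner_eq e (mem_filter.1 he).1,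
    sum_congr (s₁ := {e ∈ _ | e.2 = v}) rfl fun e he => inner_eq e (mem_filter.1 he).1]
  rfl

theorem isFlow_sinkFlow (hF : F ⊆ arcsWithoutZero G) {g : Fin n × Fin n → ℝ} {x : Fin n → ℝ}
    (hx : 0 ≤ x) (hg : ∀ e ∈ arcsWithoutZero G, 0 ≤ g e)
    (hgx : excess (arcsWithoutZero G) g = degDiff G F - x) :
    IsFlow (extendedArcs G) (netflow G F) (sinkFlow G g x) where
  nonneg
    | (some u, some v), he => by
      have he := some_some_mem_extendedArcs.1 he
      exact (hg _ he).trans_eq (if_pos he).symm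
    | (some u, none), _ => hx u
    | (none, _), _ => le_rfl
  zero_ext
    | (some u, some v), he => if_neg fun h => he (some_some_mem_extendedArcs.2 h)
    | (some u, none), he => absurd (some_none_mem_extendedArcs u) he
    | (none, _), _ => rfl
  conservation
    | some v => (excess_sinkFlow_some g x v).trans (by simp [hgx, netflow])
    | none => by
      have sum_eq : ∑ i, x i = ∑ i, degDiff G F i :=
        (mem_cutPolytope_iff_exists_excess_eq.2 ⟨hx, g, hg, hgx⟩).2.2
      rw [netflow, card_arcs_sdiff_image hF, ← sum_eq]
      exact excess_extendedArcs_none _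

theorem image_flows (hF : F ⊆ arcsWithoutZero G) :
    (fun f i => f (some i, none)) '' flows G F = cutPolytope (arcsWithoutZero G) (degDiff G F) := by
  ext x
  rw [mem_cutPolytope_iff_exists_excess_eq]
  constructor
  · rintro ⟨f, hf, rfl⟩
    refine ⟨fun u => hf.nonneg _ (some_none_mem_extendedArcs u), fun e => f (some e.1, some e.2),
      fun e he => hf.nonneg _ (some_some_mem_extendedArcs.2 he), funext fun v => ?_⟩
    exact eq_sub_of_add_eq ((excess_extendedArcs_some f v).symm.trans (hf.conservation (some v)))
  · rintro ⟨hx, g, hg, hgx⟩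
    exact ⟨sinkFlow G g x, isFlow_sinkFlow hF hx hg hgx, rfl⟩

theorem flows_nonempty_iff (hF : F ⊆ arcsWithoutZero G) :
    (flows G F).Nonempty ↔ (cutPolytope (arcsWithoutZero G) (degDiff G F)).Nonempty := by
  rw [← image_flows hF, Set.image_nonempty]

theorem sinkValues_eq_image (hF : F ⊆ arcsWithoutZero G) (I : Finset (Fin n)) :
    sinkValues G F I =
      (fun x => ∑ i ∈ I, x i) '' cutPolytope (arcsWithoutZero G) (degDiff G F) := by
  rw [← image_flows hF, Set.image_image, sinkValues]

variable (G F) in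
theorem isGenPermParam_cutBound :
    IsGenPermParam (cutBound (arcsWithoutZero G) (degDiff G F)) :=
  ⟨cutBound_empty _ _, isSupermodular_cutBound _ _⟩

theorem isLeast_sinkValues (hF : F ⊆ arcsWithoutZero G) (h : (flows G F).Nonempty)
    (I : Finset (Fin n)) :
    IsLeast (sinkValues G F I) (cutBound (arcsWithoutZero G) (degDiff G F) I) := by
  rw [sinkValues_eq_image hF, cutPolytope_eq_genPermZ ((flows_nonempty_iff hF).1 h)]
  exact (isGenPermParam_cutBound G F).isLeast_sum I

theorem zParam_eq_cutBound (hF : F ⊆ arcsWithoutZero G) (h : (flows G F).Nonempty) :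
    zParam G F = cutBound (arcsWithoutZero G) (degDiff G F) :=
  funext fun I => (isLeast_sinkValues hF h I).csInf_eq

theorem cutPolytope_eq_genPermZ_zParam (hF : F ⊆ arcsWithoutZero G) (h : (flows G F).Nonempty) :
    cutPolytope (arcsWithoutZero G) (degDiff G F) = genPermZ (zParam G F) := by
  rw [zParam_eq_cutBound hF h, cutPolytope_eq_genPermZ ((flows_nonempty_iff hF).1 h)]

end SinkFlows

/-! ### The Newton polytope of the left-degree polynomial -/

section Newton

variable {n : ℕ} {G : SimpleGraph (Fin (n + 1))} {F : Finset (Fin n × Fin n)}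

theorem toReal_mem_cutPolytope_degDiff {α : Fin n → ℤ} :
    toReal α ∈ cutPolytope (arcsWithoutZero G) (degDiff G F) ↔ α ∈ LD G F := by
  rw [← toReal_intDegDiff, toReal_mem_cutPolytope, mem_LD_iff]

theorem coeff_leftDegreePoly (m : Fin n →₀ ℕ) :
    (leftDegreePoly G F).coeff m =
      (LD G F).count (fun i => (m i : ℤ)) * ((codim G fun i => (m i : ℤ)).negOnePow : ℤ) := by
  rw [leftDegreePoly, ← MvPolynomial.coeffAddMonoidHom_apply, map_multiset_sum, Multiset.map_map,
    Multiset.sum_map_eq_nsmul_single fun i => (m i : ℤ)]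
  · simp
  · intro α hα hαLD
    refine (MvPolynomial.coeff_monomial _ _ _).trans (if_neg fun h => hα ?_)
    exact funext fun i => by simpa [← h] using (mem_LD_iff.1 hαLD).1 i

theorem coeff_leftDegreePoly_ne_zero {m : Fin n →₀ ℕ} :
    (leftDegreePoly G F).coeff m ≠ 0 ↔ (fun i => (m i : ℤ)) ∈ LD G F := by
  rw [coeff_leftDegreePoly, mul_ne_zero_iff, and_iff_left (Units.ne_zero _), Nat.cast_ne_zero,
    Multiset.count_ne_zero]

theorem exists_coeff_ne_zero {α : Fin n → ℤ} (hα : α ∈ LD G F) :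
    ∃ m : Fin n →₀ ℕ, (leftDegreePoly G F).coeff m ≠ 0 ∧ ∀ i, (m i : ℤ) = α i := by
  lift α to Fin n → ℕ using (mem_LD_iff.1 hα).1
  exact ⟨Finsupp.equivFunOnFinite.symm α, coeff_leftDegreePoly_ne_zero.2 hα, fun _ => rfl⟩

theorem newton_leftDegreePoly :
    newton (leftDegreePoly G F) = convexHull ℝ (toReal '' {α | α ∈ LD G F}) := by
  refine congrArg _ <| Set.ext fun x => ⟨?_, ?_⟩
  · rintro ⟨m, hm, rfl⟩
    exact ⟨_, coeff_leftDegreePoly_ne_zero.1 (MvPolynomial.mem_support_iff.1 hm),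
      funext fun i => Int.cast_natCast (m i)⟩
  · rintro ⟨α, hα, rfl⟩
    obtain ⟨m, hm, hmα⟩ := exists_coeff_ne_zero hα
    exact ⟨m, MvPolynomial.mem_support_iff.2 hm, funext fun i => by simp [toReal, ← hmα]⟩

theorem newton_leftDegreePoly_eq_cutPolytope :
    newton (leftDegreePoly G F) = cutPolytope (arcsWithoutZero G) (degDiff G F) := by
  have setOf_mem_LD : {α | α ∈ LD G F} = cutPolytope (arcsWithoutZero G) (intDegDiff G F) :=
    Set.ext fun _ => mem_LD_iff
  rw [newton_leftDegreePoly, setOf_mem_LD, convexHull_intPoints_cutPolytope, toReal_intDegDiff]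

theorem hasPolytopalSupport_leftDegreePoly : HasPolytopalSupport (leftDegreePoly G F) :=
  fun _ hα => exists_coeff_ne_zero <|
    toReal_mem_cutPolytope_degDiff.1 (newton_leftDegreePoly_eq_cutPolytope ▸ hα)

theorem LD_eq_zero_of_not_nonempty_cutPolytope
    (h : ¬ (cutPolytope (arcsWithoutZero G) (degDiff G F)).Nonempty) : LD G F = 0 :=
  Multiset.eq_zero_of_forall_notMem fun α hα => h ⟨toReal α, toReal_mem_cutPolytope_degDiff.2 hα⟩

end Newton

/-! ### Minkowski sums of simplices -/

section Transport

variable {ι κ R : Type*} [Fintype ι] [Fintype κ] [DecidableEq κ] [AddCommGroup R] [LinearOrder R]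
  [IsOrderedAddMonoid R]

theorem exists_transport_plan {I : ι → Finset κ} {b : ι → R} {x : κ → R} (hx : 0 ≤ x)
    (hbx : ∑ i, b i = ∑ k, x k) (hall : ∀ S, ∑ i ∈ S, b i ≤ ∑ k ∈ S.biUnion I, x k) :
    ∃ p : ι → κ → R, (∀ i, 0 ≤ p i ∧ (∀ k ∉ I i, p i k = 0) ∧ ∑ k, p i k = b i) ∧
      ∑ i, p i = x := by
  classical
  set E : Finset ((ι ⊕ κ) × (ι ⊕ κ)) :=
    (univ.sigma I).image fun e => (Sum.inl e.1, Sum.inr e.2) with hE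
  obtain ⟨g, hg, hgd⟩ := exists_nonneg_excess_eq E (d := Sum.elim b (-x)) (by simp [hbx])
    fun J hJ => by
      have biUnion_subset : J.toLeft.biUnion I ⊆ J.toRight := biUnion_subset.2 fun i hi k hk =>
        mem_toRight.2 <| hJ (.inl i, .inr k)
          (mem_image.2 ⟨⟨i, k⟩, mem_sigma.2 ⟨mem_univ i, hk⟩, rfl⟩) (mem_toLeft.1 hi)
      rw [← toLeft_disjSum_toRight (u := J), sum_disjSum]
      simpa using (hall J.toLeft).trans
        (sum_le_sum_of_subset_of_nonneg biUnion_subset fun k _ _ => hx k)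
  have sum_filter_E : ∀ (P : (ι ⊕ κ) × (ι ⊕ κ) → Prop) [DecidablePred P], ∑ e ∈ E with P e, g e =
      ∑ i, ∑ k ∈ I i, if P (.inl i, .inr k) then g (.inl i, .inr k) else 0 := fun P _ => by
    rw [sum_filter, hE, sum_image, sum_sigma]
    exact Function.Injective.injOn fun _ _ h => by simpa [Sigma.ext_iff] using h
  refine ⟨fun i k => if k ∈ I i then g (.inl i, .inr k) else 0, fun i => ⟨fun k => ?_,
    fun k hk => if_neg hk, ?_⟩, funext fun k => ?_⟩
  · dsimp only
    split_ifs
    exacts [hg _, le_rfl]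
  · simpa [excess, sum_filter_E] using congrFun hgd (.inl i)
  · simpa [excess, sum_filter_E] using congrFun hgd (.inr k)

end Transport

section Simplices

variable {n : ℕ} {I : Finset (Fin n)}

theorem simplexFace_of_nonempty (hI : I.Nonempty) :
    simplexFace I = convexHull ℝ ((fun i => Pi.single i (1 : ℝ)) '' (I : Set (Fin n))) :=
  if_neg hI.ne_empty

theorem simplexFace_nonempty (I : Finset (Fin n)) : (simplexFace I).Nonempty := by
  obtain rfl | hI := I.eq_empty_or_nonempty
  · simp [simplexFace]
  · rw [simplexFace_of_nonempty hI]
    exact (Set.Nonempty.image _ hI).convexHull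

theorem mem_simplexFace (hI : I.Nonempty) {y : Fin n → ℝ} :
    y ∈ simplexFace I ↔ 0 ≤ y ∧ (∀ i ∉ I, y i = 0) ∧ ∑ i, y i = 1 := by
  rw [simplexFace_of_nonempty hI]
  constructor
  · have convex_face : Convex ℝ (stdSimplex ℝ (Fin n) ∩ ⋂ i ∉ I, {y | y i = 0}) :=
      (convex_stdSimplex ℝ (Fin n)).inter <| convex_iInter₂ fun i _ =>
        convex_hyperplane (LinearMap.proj i : (Fin n → ℝ) →ₗ[ℝ] ℝ).isLinear 0
    have single_mem : (fun i => Pi.single i (1 : ℝ)) '' (I : Set (Fin n)) ⊆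
        stdSimplex ℝ (Fin n) ∩ ⋂ i ∉ I, {y | y i = 0} := by
      rintro _ ⟨i, hi, rfl⟩
      exact ⟨single_mem_stdSimplex ℝ i, Set.mem_iInter₂.2 fun j hj =>
        Pi.single_eq_of_ne (ne_of_mem_of_not_mem hi hj).symm 1⟩
    intro hy
    obtain ⟨⟨hy_nonneg, hy_sum⟩, hy_zero⟩ := convexHull_min single_mem convex_face hy
    exact ⟨hy_nonneg, fun i hi => Set.mem_iInter₂.1 hy_zero i hi, hy_sum⟩
  · rintro ⟨hy_nonneg, hy_zero, hy_sum⟩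
    have sum_I : ∑ i ∈ I, y i = 1 :=
      hy_sum ▸ sum_subset (subset_univ I) fun i _ hi => hy_zero i hi
    have sum_single : ∑ i ∈ I, y i • Pi.single i (1 : ℝ) = y := funext fun j => by
      simpa [Pi.single_apply] using fun hj => (hy_zero j hj).symm
    rw [← sum_single]
    exact (convex_convexHull ℝ _).sum_mem (fun i _ => hy_nonneg i) sum_I fun i hi =>
      subset_convexHull ℝ _ (Set.mem_image_of_mem _ hi)

theorem mem_smul_simplexFace (hI : I.Nonempty) {c : ℝ} (hc : 0 ≤ c) {y : Fin n → ℝ} :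
    y ∈ c • simplexFace I ↔ 0 ≤ y ∧ (∀ i ∉ I, y i = 0) ∧ ∑ i, y i = c := by
  obtain rfl | hc := hc.eq_or_lt
  · rw [Set.zero_smul_set (simplexFace_nonempty I), Set.mem_zero]
    refine ⟨by rintro rfl; simp, fun ⟨hy_nonneg, _, hy_sum⟩ => funext fun i => ?_⟩
    exact (sum_eq_zero_iff_of_nonneg fun i _ => hy_nonneg i).1 hy_sum i (mem_univ i)
  · rw [Set.mem_smul_set_iff_inv_smul_mem₀ hc.ne', mem_simplexFace hI,
      smul_nonneg_iff_nonneg_of_pos_left (inv_pos.2 hc)]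
    simp [← mul_sum, hc.ne', inv_mul_eq_one₀, eq_comm]

theorem mem_sum_smul_simplexFace_iff {ι : Type*} [Fintype ι]
    {I : ι → Finset (Fin n)} (hI : ∀ i, (I i).Nonempty) {b : ι → ℝ} (hb : 0 ≤ b) {x : Fin n → ℝ} :
    x ∈ ∑ i, b i • simplexFace (I i) ↔ 0 ≤ x ∧ ∑ i, b i = ∑ k, x k ∧
      ∀ S, ∑ i ∈ S, b i ≤ ∑ k ∈ S.biUnion I, x k := by
  simp only [Set.mem_finsetSum, mem_univ, forall_const]
  constructor
  · rintro ⟨p, hp, rfl⟩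
    have hp := fun i => (mem_smul_simplexFace (hI i) (hb i)).1 (hp (i := i))
    refine ⟨sum_nonneg fun i _ => (hp i).1, ?_, fun S => ?_⟩
    · simp only [Finset.sum_apply]
      rw [sum_comm]
      exact sum_congr rfl fun i _ => (hp i).2.2.symm
    · simp only [Finset.sum_apply]
      rw [sum_comm]
      calc ∑ i ∈ S, b i = ∑ i ∈ S, ∑ k ∈ S.biUnion I, p i k :=
            sum_congr rfl fun i hi => by
              rw [← (hp i).2.2]
              exact (sum_subset (subset_univ _) fun k _ hk => (hp i).2.1 k fun hkI =>
                hk (mem_biUnion.2 ⟨i, hi, hkI⟩)).symm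
        _ ≤ ∑ i, ∑ k ∈ S.biUnion I, p i k :=
            sum_le_sum_of_subset_of_nonneg (subset_univ S) fun i _ _ =>
              sum_nonneg fun k _ => (hp i).1 k
  · rintro ⟨hx, hbx, hall⟩
    obtain ⟨p, hp, hpx⟩ := exists_transport_plan hx hbx hall
    exact ⟨p, fun {i} => (mem_smul_simplexFace (hI i) (hb i)).2 (hp i), hpx⟩

end Simplices

section Reachability

variable {n : ℕ} {G : SimpleGraph (Fin (n + 1))} {F : Finset (Fin n × Fin n)}

theorem mem_reachable {i k : Fin n} :
    k ∈ reachable G i ↔ Relation.ReflTransGen (fun u v => (u, v) ∈ arcsWithoutZero G) i k := by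
  simp [reachable]

theorem self_mem_reachable (i : Fin n) : i ∈ reachable G i :=
  mem_reachable.2 Relation.ReflTransGen.refl

theorem outClosed_reachable (i : Fin n) : OutClosed (arcsWithoutZero G) (reachable G i) :=
  fun _ he h => mem_reachable.2 ((mem_reachable.1 h).tail he)

theorem OutClosed.reachable_subset {J : Finset (Fin n)} (hJ : OutClosed (arcsWithoutZero G) J)
    {i : Fin n} (hi : i ∈ J) : reachable G i ⊆ J := fun k hk => by
  induction mem_reachable.1 hk with
  | refl => exact hi
  | tail hreach harc ih => exact hJ _ harc (ih (mem_reachable.2 hreach))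

theorem le_of_mem_reachable {i k : Fin n} (h : k ∈ reachable G i) : i ≤ k := by
  induction mem_reachable.1 h with
  | refl => exact le_rfl
  | tail hreach harc ih => exact (ih (mem_reachable.2 hreach)).trans (fst_lt_snd harc).le

theorem reachable_injective : Function.Injective (reachable G) := fun i j h =>
  (le_of_mem_reachable (h ▸ self_mem_reachable j)).antisymm
    (le_of_mem_reachable (h ▸ self_mem_reachable i))

theorem outClosed_biUnion_reachable (S : Finset (Fin n)) :
    OutClosed (arcsWithoutZero G) (S.biUnion (reachable G)) := fun e he h => by
  obtain ⟨i, hi, hei⟩ := mem_biUnion.1 h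
  exact mem_biUnion.2 ⟨i, hi, outClosed_reachable i e he hei⟩

theorem minkowskiSum_eq_cutPolytope (hb : 0 ≤ degDiff G F) :
    minkowskiSum G F = cutPolytope (arcsWithoutZero G) (degDiff G F) := by
  ext x
  rw [minkowskiSum, mem_sum_smul_simplexFace_iff (fun i => ⟨i, self_mem_reachable i⟩) hb]
  refine and_congr_right fun hx => ⟨fun ⟨hsum, hall⟩ => ⟨fun J hJ => ?_, hsum.symm⟩,
    fun ⟨hcut, hsum⟩ => ⟨hsum.symm, fun S => ?_⟩⟩
  · exact (hall J).trans <| sum_le_sum_of_subset_of_nonneg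
      (biUnion_subset.2 fun i hi => hJ.reachable_subset hi) fun k _ _ => hx k
  · exact (sum_le_sum_of_subset_of_nonneg
      (fun i hi => mem_biUnion.2 ⟨i, hi, self_mem_reachable i⟩) fun i _ _ => hb i).trans
      (hcut _ (outClosed_biUnion_reachable S))

end Reachability

/-! ### Join-irreducible closed sets -/

section JoinIrreducible

variable {n : ℕ} {G : SimpleGraph (Fin (n + 1))} {F : Finset (Fin n × Fin n)}

theorem mem_closedSets {J : Finset (Fin n)} :
    J ∈ closedSets G ↔ OutClosed (arcsWithoutZero G) J :=
  outdegSet_eq_zero G J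

variable (G) in
/-- The set `δ(k)` as an element of the lattice of closed sets; these are the join-irreducible
elements. -/
noncomputable def closedReachable (k : Fin n) : closedSets G :=
  ⟨reachable G k, mem_closedSets.2 (outClosed_reachable k)⟩

theorem closedReachable_le_iff {k : Fin n} {A : closedSets G} :
    closedReachable G k ≤ A ↔ k ∈ (A : Finset (Fin n)) :=
  ⟨fun h => h (self_mem_reachable k), (mem_closedSets.1 A.2).reachable_subset⟩

theorem erase_reachable_mem_closedSets (k : Fin n) : (reachable G k).erase k ∈ closedSets G :=
  mem_closedSets.2 fun e he h => by
    have reach_fst := mem_of_mem_erase h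
    exact mem_erase.2 ⟨((le_of_mem_reachable reach_fst).trans_lt (fst_lt_snd he)).ne',
      outClosed_reachable k e he reach_fst⟩

theorem erase_reachable_covBy (k : Fin n) :
    (⟨_, erase_reachable_mem_closedSets k⟩ : closedSets G) ⋖ closedReachable G k :=
  CovBy.of_image (OrderEmbedding.subtype (· ∈ closedSets G))
    (erase_covBy (self_mem_reachable k))

theorem supIrred_closedReachable (k : Fin n) : SupIrred (closedReachable G k) := by
  refine ⟨fun hmin => (erase_reachable_covBy k).lt.not_isMin hmin, fun B C hBC => ?_⟩
  have hk : k ∈ (B : Finset (Fin n)) ∪ C := closedReachable_le_iff.1 hBC.ge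
  exact (mem_union.1 hk).imp
    (fun h => (le_sup_left.trans_eq hBC).antisymm (closedReachable_le_iff.2 h))
    (fun h => (le_sup_right.trans_eq hBC).antisymm (closedReachable_le_iff.2 h))

theorem eq_closedReachable_of_covBy {A A' : closedSets G} (hA : SupIrred A) (hcov : A' ⋖ A)
    {k : Fin n} (hkA : k ∈ (A : Finset (Fin n))) (hkA' : k ∉ (A' : Finset (Fin n))) :
    A = closedReachable G k := by
  have sup_eq : A' ⊔ closedReachable G k = A :=
    (hcov.eq_or_eq le_sup_left (sup_le hcov.le (closedReachable_le_iff.2 hkA))).resolve_left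
      fun h => hkA' (closedReachable_le_iff.1 (le_sup_right.trans_eq h))
  exact ((hA.2 sup_eq).resolve_left hcov.ne).symm

theorem exists_supIrred_covBy_iff {J : Finset (Fin n)} {k : Fin n} :
    (∃ A A' : closedSets G, (A : Finset (Fin n)) = J ∧ SupIrred A ∧ A' ⋖ A ∧
      (A : Finset (Fin n)) \ (A' : Finset (Fin n)) = {k}) ↔ reachable G k = J := by
  constructor
  · rintro ⟨A, A', rfl, hA, hcov, hk⟩
    obtain ⟨hkA, hkA'⟩ := mem_sdiff.1 (hk ▸ mem_singleton_self k)
    exact congrArg Subtype.val (eq_closedReachable_of_covBy hA hcov hkA hkA').symm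
  · rintro rfl
    exact ⟨closedReachable G k, _, rfl, supIrred_closedReachable k, erase_reachable_covBy k,
      sdiff_erase_self (self_mem_reachable k)⟩

theorem yParam_reachable (k : Fin n) : yParam G F (reachable G k) = degDiff G F k := by
  simp only [yParam, exists_supIrred_covBy_iff, reachable_injective.eq_iff]
  simp

theorem yParam_eq_zero {J : Finset (Fin n)} (hJ : J ∉ Set.range (reachable G)) :
    yParam G F J = 0 := by
  simp only [yParam, exists_supIrred_covBy_iff]
  exact sum_eq_zero fun k _ => if_neg fun h => hJ ⟨k, h⟩

theorem genPermY_yParam : genPermY (yParam G F) = minkowskiSum G F := by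
  rw [genPermY, minkowskiSum, ← sum_subset (subset_univ (univ.image (reachable G))) ?_,
    sum_image reachable_injective.injOn]
  · exact sum_congr rfl fun i _ => by rw [yParam_reachable]
  · intro J _ hJ
    rw [yParam_eq_zero (by simpa using hJ), Set.zero_smul_set (simplexFace_nonempty J)]

end JoinIrreducible

end LeftDegree

theorem mainTheorem6 (n : ℕ) (G : SimpleGraph (Fin (n + 1))) (F : Finset (Fin n × Fin n))
    (hF : F ⊆ arcsWithoutZero G) :
    newton (leftDegreePoly G F) = convexHull ℝ (toReal '' {α | α ∈ LD G F}) ∧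
    HasPolytopalSupport (leftDegreePoly G F) ∧
    (¬ (flows G F).Nonempty → LD G F = 0) ∧
    ((flows G F).Nonempty →
      (∀ I, IsLeast (sinkValues G F I) (zParam G F I)) ∧
      IsGenPermParam (zParam G F) ∧
      newton (leftDegreePoly G F) = genPermZ (zParam G F) ∧
      ∀ α : Fin n → ℤ, toReal α ∈ genPermZ (zParam G F) → α ∈ LD G F) ∧
    ((∀ i, outdeg F i ≤ indeg G i) →
      (flows G F).Nonempty ∧
      genPermY (yParam G F) = genPermZ (zParam G F) ∧
      newton (leftDegreePoly G F) = minkowskiSum G F) := by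
  have polytope := newton_leftDegreePoly_eq_cutPolytope (G := G) (F := F)
  refine ⟨newton_leftDegreePoly, hasPolytopalSupport_leftDegreePoly, fun h => ?_, fun h => ?_,
    fun hb => ?_⟩
  · exact LD_eq_zero_of_not_nonempty_cutPolytope fun hcut => h ((flows_nonempty_iff hF).2 hcut)
  · rw [polytope, ← cutPolytope_eq_genPermZ_zParam hF h, zParam_eq_cutBound hF h]
    exact ⟨isLeast_sinkValues hF h, isGenPermParam_cutBound G F, rfl,
      fun _ => toReal_mem_cutPolytope_degDiff.1⟩
  · have b_nonneg : 0 ≤ degDiff G F := fun i => sub_nonneg.2 (Nat.cast_le.2 (hb i))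
    have h : (flows G F).Nonempty :=
      (flows_nonempty_iff hF).2 ⟨_, mem_cutPolytope_self (arcsWithoutZero G) b_nonneg⟩
    rw [genPermY_yParam, minkowskiSum_eq_cutPolytope b_nonneg, polytope]
    exact ⟨h, cutPolytope_eq_genPermZ_zParam hF h, rfl⟩
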